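/- **Setting.** Let $\mathcal S^d$ be the space of real symmetric $d\times d$ matrices with the inner product $\langle U,W\rangle=\sum_{i,j}U_{ij}W_{ij}$ and the Frobenius norm $\|\cdot\|_F$, let $\mathcal S^d_+$ be the cone of positive semidefinite matrices, and let $\|U\|_{(r)}$ be the sum of the $r$ largest singular values of $U$. Let $n\ge 1$, $1\le r\le d$, $c>0$, $\alpha>0$, $\kappa\in(0,1)$, $b\in\mathbb R^p$, and let $\mathcal A:\mathcal S^d\to\mathbb R^p$ be linear and satisfy the $r$-restricted isometry property: the smallest $R_r$ such that $(1-R_r)\|U\|_F^2\le\|\mathcal A(U)\|^2\le(1+R_r)\|U\|_F^2$ for all $U\in\mathcal S^d_+$ of rank at most $r$ satisfies $0\le R_r<1$. Put $$f_1(U)=\tfrac1n\|\mathcal A(U)-b\|^2+c\langle U,I\rangle,\qquad f_2(U)=c\|U\|_{(r)},\qquad J_c=f_1-f_2,$$ and consider the problem $\min_{U\in\mathcal S^d_+}J_c(U)$. Let $f_2^*(W)=\sup_{U\in\mathcal S^d_+}\{\langle W,U\rangle-f_2(U)\}$, and let $\partial f_2$ be the convex subdifferential of $f_2$ on $\mathcal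 S^d$. **Algorithm** (s-iPDCA with stopping tolerance $0$). Let $(\epsilon_{k+1})_{k\ge0}$ be nonnegative and nonincreasing with limit $0$. Start from $U^0=V^0\in\mathcal S^d_+$ and $W^0\in\partial f_2(U^0)$. In iteration $k\ge 0$ compute $V^{k+1}$ and $\Delta^{k+1}\in\mathcal S^d$ with $\|\Delta^{k+1}\|_F\le\epsilon_{k+1}$ such that $V^{k+1}$ minimizes $$f_1(U)-\langle U,W^k\rangle+\tfrac\alpha2\|U-U^k\|_F^2-\langle\Delta^{k+1},U\rangle$$ over $U\in\mathcal S^d_+$. If $V^{k+1}=U^k$, stop. If $\|\Delta^{k+1}\|_F<\frac{(1-\kappa)\alpha}2\|V^{k+1}-U^k\|_F$ (a serious step), set $U^{k+1}=V^{k+1}$ and choose any $W^{k+1}\in\partial f_2(U^{k+1})$; otherwise (a null step) set $U^{k+1}=U^k$ and $W^{k+1}=W^k$. Suppose that infinitely many serious steps are performed. Let $k_0=0$ and, for $l\ge1$, let $U^{k_l}$ be the iterate produced by the $l$-th serious step. Define $E:(\mathcal S^d)^4\to(-\infty,\infty]$ by $$E(U,W,V,T)=f_1(U)-\langle U,W\rangle+f_2^*(W)+\tfrac\alpha2\|U-V\|_F^2-\langle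 T,U-V\rangle\quad\text{if }U\in\mathcal S^d_+,$$ and $E(U,W,V,T)=\infty$ if $U\notin\mathcal S^d_+$. Let $z_l=(U^{k_{l+1}},W^{k_l},U^{k_l},\Delta^{k_{l+1}})$ for $l\ge0$. **Proposition.** $E(z_l)$ is finite for every $l\ge0$, and the following hold. 1. $J_c(U^{k_{l+1}})\le E(z_l)$ for all $l\ge0$. 2. $E(z_l)-E(z_{l-1})\le-\frac{\kappa\alpha}2\|U^{k_l}-U^{k_{l-1}}\|_F^2$ for all $l\ge1$. 3. The set $\Gamma$ of accumulation points of $(z_l)$ is nonempty and compact. 4. The limit $\Upsilon=\lim_{l\to\infty}E(z_l)$ exists in $\mathbb R$, and $E\equiv\Upsilon$ on $\Gamma$. 5. There is $\rho>0$ such that $\operatorname{dist}(0,\partial E(z_l))\le\rho\|U^{k_{l+1}}-U^{k_l}\|_F$ for all $l\ge0$, where $\partial E$ is the limiting subdifferential (in particular $\partial E(z_l)\ne\emptyset$). -/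

import Mathlib

open Filter Topology
open scoped RealInnerProductSpace

noncomputable section

/-- The linear subspace of symmetric matrices inside the real `d × d` matrices. -/
def symSubmodule (d : ℕ) : Submodule ℝ (Matrix (Fin d) (Fin d) ℝ) where
  carrier := {M | M.IsSymm}
  add_mem' := fun ha hb => Matrix.IsSymm.add ha hb
  zero_mem' := Matrix.isSymm_zero
  smul_mem' := fun c _ h => Matrix.IsSymm.smul h c

/-- The space `S^d` of real symmetric `d × d` matrices; below it gets the inner product
`⟪U, W⟫ = ∑ i j, U i j * W i j`, so that its norm is the Frobenius norm. -/
def SymMat (d : ℕ) : Type := symSubmodule d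

namespace SymMat

variable {d : ℕ}

instance : AddCommGroup (SymMat d) := inferInstanceAs (AddCommGroup (symSubmodule d))
instance : Module ℝ (SymMat d) := inferInstanceAs (Module ℝ (symSubmodule d))
instance : FiniteDimensional ℝ (SymMat d) :=
  inferInstanceAs (FiniteDimensional ℝ (symSubmodule d))

/-- The underlying matrix, as a linear map. -/
def toMat : SymMat d →ₗ[ℝ] Matrix (Fin d) (Fin d) ℝ := (symSubmodule d).subtype

theorem toMat_injective : Function.Injective (toMat (d := d)) := Subtype.val_injective

/-- The identity matrix as an element of `S^d`. -/
def ident (d : ℕ) : SymMat d := ⟨1, Matrix.isSymm_one⟩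

theorem toMat_ident : toMat (ident d) = 1 := rfl

/-- The Frobenius inner product. -/
@[reducible] def innerCore (d : ℕ) : InnerProductSpace.Core ℝ (SymMat d) where
  inner U W := ∑ i, ∑ j, toMat U i j * toMat W i j
  conj_inner_symm U W := by
    simp only [conj_trivial]
    exact Finset.sum_congr rfl fun i _ => Finset.sum_congr rfl fun j _ => mul_comm _ _
  re_inner_nonneg U := by
    simp only [RCLike.re_to_real]
    exact Finset.sum_nonneg fun i _ => Finset.sum_nonneg fun j _ => mul_self_nonneg _
  add_left U V W := by
    simp [add_mul, Finset.sum_add_distrib]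
  smul_left U W t := by
    simp [Finset.mul_sum, mul_assoc]
  definite U h := by
    apply toMat_injective
    ext i j
    have h1 := (Finset.sum_eq_zero_iff_of_nonneg (fun i _ =>
      Finset.sum_nonneg fun j _ => mul_self_nonneg (toMat U i j))).1 h i (Finset.mem_univ i)
    have h2 := (Finset.sum_eq_zero_iff_of_nonneg (fun j _ =>
      mul_self_nonneg (toMat U i j))).1 h1 j (Finset.mem_univ j)
    simpa using h2

instance : NormedAddCommGroup (SymMat d) := (innerCore d).toNormedAddCommGroup
instance : InnerProductSpace ℝ (SymMat d) := InnerProductSpace.ofCore (innerCore d).toCore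

theorem inner_eq (U W : SymMat d) : ⟪U, W⟫ = ∑ i, ∑ j, toMat U i j * toMat W i j := rfl

end SymMat

/-- The cone `S^d_+` of positive semidefinite matrices. -/
def psdCone (d : ℕ) : Set (SymMat d) := {U | (SymMat.toMat U).PosSemidef}

/-- The Ky Fan `r`-norm: the sum of the `r` largest singular values
(Mathlib lists the singular values in nonincreasing order, starting from index `0`). -/
def kyFan {d : ℕ} (r : ℕ) (U : SymMat d) : ℝ :=
  ∑ i ∈ Finset.range r, (Matrix.toEuclideanLin (SymMat.toMat U)).singularValues i

/-- The restricted isometry inequalities with constant `R`, on the elements of `S^d_+` of rank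
at most `r`. -/
def RIPBound {d p : ℕ} (A : SymMat d →ₗ[ℝ] EuclideanSpace ℝ (Fin p)) (r : ℕ) (R : ℝ) : Prop :=
  ∀ U ∈ psdCone d, (SymMat.toMat U).rank ≤ r →
    (1 - R) * ‖U‖ ^ 2 ≤ ‖A U‖ ^ 2 ∧ ‖A U‖ ^ 2 ≤ (1 + R) * ‖U‖ ^ 2

/-- The `r`-restricted isometry property: the smallest constant `R` in the restricted isometry
inequalities satisfies `0 ≤ R < 1`. -/
def SatisfiesRIP {d p : ℕ} (A : SymMat d →ₗ[ℝ] EuclideanSpace ℝ (Fin p)) (r : ℕ) : Prop :=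
  ∃ R : ℝ, IsLeast {R' | RIPBound A r R'} R ∧ 0 ≤ R ∧ R < 1

/-- `f₁(U) = (1/n) ‖A U - b‖² + c ⟪U, I⟫`. -/
def f1 {d p : ℕ} (n : ℕ) (A : SymMat d →ₗ[ℝ] EuclideanSpace ℝ (Fin p))
    (b : EuclideanSpace ℝ (Fin p)) (c : ℝ) (U : SymMat d) : ℝ :=
  1 / (n : ℝ) * ‖A U - b‖ ^ 2 + c * ⟪U, SymMat.ident d⟫

/-- `f₂(U) = c ‖U‖_(r)`. -/
def f2 {d : ℕ} (r : ℕ) (c : ℝ) (U : SymMat d) : ℝ := c * kyFan r U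

/-- The objective `J_c = f₁ - f₂` of the problem of minimizing `J_c` over `S^d_+`. -/
def Jc {d p : ℕ} (n : ℕ) (A : SymMat d →ₗ[ℝ] EuclideanSpace ℝ (Fin p))
    (b : EuclideanSpace ℝ (Fin p)) (r : ℕ) (c : ℝ) (U : SymMat d) : ℝ :=
  f1 n A b c U - f2 r c U

/-- The subdifferential of a (convex) real-valued function on an inner product space. -/
def convexSubdiff {H : Type*} [NormedAddCommGroup H] [InnerProductSpace ℝ H]
    (f : H → ℝ) (x : H) : Set H :=
  {v | ∀ y, f x + ⟪v, y - x⟫ ≤ f y}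

/-- The conjugate `f₂*(W) = sup {⟪W, U⟫ - f₂(U) | U ∈ S^d_+}`, with values in `[-∞, ∞]`. -/
def f2conj {d : ℕ} (r : ℕ) (c : ℝ) (W : SymMat d) : EReal :=
  ⨆ U ∈ psdCone d, ((⟪W, U⟫ - f2 r c U : ℝ) : EReal)

/-- The space of quadruples `(U, W, V, T)` of symmetric matrices with the Euclidean norm. -/
abbrev Quad (d : ℕ) : Type := PiLp 2 (fun _ : Fin 4 => SymMat d)

/-- The quadruple `(U, W, V, T)`. -/
def quad {d : ℕ} (U W V T : SymMat d) : Quad d := WithLp.toLp 2 ![U, W, V, T]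

open Classical in
/-- The auxiliary function
`E(U, W, V, T) = f₁(U) - ⟪U, W⟫ + f₂*(W) + (α/2) ‖U - V‖² - ⟪T, U - V⟫`,
an extended-real-valued function in which `f₁` has the domain `S^d_+`, that is,
`E = ∞` for `U` outside `S^d_+`. -/
def auxE {d p : ℕ} (n : ℕ) (A : SymMat d →ₗ[ℝ] EuclideanSpace ℝ (Fin p))
    (b : EuclideanSpace ℝ (Fin p)) (r : ℕ) (c α : ℝ) (z : Quad d) : EReal :=
  if z 0 ∈ psdCone d then
    ((f1 n A b c (z 0) - ⟪z 0, z 1⟫ + α / 2 * ‖z 0 - z 2‖ ^ 2 - ⟪z 3, z 0 - z 2⟫ : ℝ) : EReal)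
      + f2conj r c (z 1)
  else ⊤

/-- The regular (Fréchet) subdifferential of an extended-real-valued function:
`v` with `f y ≥ f x + ⟪v, y - x⟫ + o(‖y - x‖)`; it is empty where `f` is not finite. -/
def regularSubdiff {H : Type*} [NormedAddCommGroup H] [InnerProductSpace ℝ H]
    (f : H → EReal) (x : H) : Set H :=
  {v | f x ≠ ⊤ ∧ f x ≠ ⊥ ∧ ∀ ε : ℝ, 0 < ε →
    ∀ᶠ y in 𝓝 x, f x + ((⟪v, y - x⟫ - ε * ‖y - x‖ : ℝ) : EReal) ≤ f y}

/-- The (limiting) subdifferential of an extended-real-valued function: the limits of regular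
subgradients `vs m` at points `xs m → x` with `f (xs m) → f x`. -/
def limitingSubdiff {H : Type*} [NormedAddCommGroup H] [InnerProductSpace ℝ H]
    (f : H → EReal) (x : H) : Set H :=
  {v | f x ≠ ⊤ ∧ f x ≠ ⊥ ∧ ∃ xs vs : ℕ → H,
    Tendsto xs atTop (𝓝 x) ∧ Tendsto (fun m => f (xs m)) atTop (𝓝 (f x)) ∧
    (∀ m, vs m ∈ regularSubdiff f (xs m)) ∧ Tendsto vs atTop (𝓝 v)}

/-- The objective of the perturbed proximal subproblem with linearization `W`, proximal center
`U₀` and inexactness term `D`. -/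
def subObj {d p : ℕ} (n : ℕ) (A : SymMat d →ₗ[ℝ] EuclideanSpace ℝ (Fin p))
    (b : EuclideanSpace ℝ (Fin p)) (c α : ℝ) (W U₀ D U : SymMat d) : ℝ :=
  f1 n A b c U - ⟪U, W⟫ + α / 2 * ‖U - U₀‖ ^ 2 - ⟪D, U⟫

/-- The test for a serious step in iteration `k`. -/
def IsSerious {d : ℕ} (α κ : ℝ) (U V Δ : ℕ → SymMat d) (k : ℕ) : Prop :=
  ‖Δ (k + 1)‖ < (1 - κ) * α / 2 * ‖V (k + 1) - U k‖

/-- `(U, V, W, Δ)` is a nonterminating run of the inexact proximal DC algorithm with sieving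
strategy, with stopping tolerance `tol`; `U` are the stability centers, `V` the trial points,
`W` the chosen subgradients, `Δ (k + 1)` the inexactness terms (the entry `Δ 0` is not used)
and `eps k` is the error bound `ε_{k+1}` of iteration `k`. -/
structure IsRun {d p : ℕ} (n : ℕ) (A : SymMat d →ₗ[ℝ] EuclideanSpace ℝ (Fin p))
    (b : EuclideanSpace ℝ (Fin p)) (r : ℕ) (c α κ tol : ℝ) (eps : ℕ → ℝ)
    (U V W Δ : ℕ → SymMat d) : Prop where
  eps_nonneg : ∀ k, 0 ≤ eps k
  eps_antitone : Antitone eps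
  eps_tendsto : Tendsto eps atTop (𝓝 0)
  init_eq : U 0 = V 0
  init_mem : U 0 ∈ psdCone d
  init_subgrad : W 0 ∈ convexSubdiff (f2 r c) (U 0)
  inexact : ∀ k, ‖Δ (k + 1)‖ ≤ eps k
  trial_mem : ∀ k, V (k + 1) ∈ psdCone d
  trial_min : ∀ k, IsMinOn (subObj n A b c α (W k) (U k) (Δ (k + 1))) (psdCone d) (V (k + 1))
  no_stop : ∀ k, tol < ‖V (k + 1) - U k‖
  serious_center : ∀ k, IsSerious α κ U V Δ k → U (k + 1) = V (k + 1)
  serious_subgrad : ∀ k, IsSerious α κ U V Δ k → W (k + 1) ∈ convexSubdiff (f2 r c) (U (k + 1))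
  null_center : ∀ k, ¬ IsSerious α κ U V Δ k → U (k + 1) = U k
  null_subgrad : ∀ k, ¬ IsSerious α κ U V Δ k → W (k + 1) = W k

/-- The index `k_l` of the stability center produced by the `l`-th serious step, for `l ≥ 1`;
`k_0 = 0` is the index of the starting point. -/
def seriousIdx {d : ℕ} (α κ : ℝ) (U V Δ : ℕ → SymMat d) : ℕ → ℕ
  | 0 => 0
  | l + 1 => Nat.nth (IsSerious α κ U V Δ) l + 1

/-- The quadruple `(U^{k_{l+1}}, W^{k_l}, U^{k_l}, Δ^{k_{l+1}})`. -/
def seriousQuad {d : ℕ} (α κ : ℝ) (U V W Δ : ℕ → SymMat d) (l : ℕ) : Quad d :=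
  quad (U (seriousIdx α κ U V Δ (l + 1))) (W (seriousIdx α κ U V Δ l))
    (U (seriousIdx α κ U V Δ l)) (Δ (seriousIdx α κ U V Δ (l + 1)))

/-- The set of accumulation points of a sequence. -/
def accPts {X : Type*} [TopologicalSpace X] (x : ℕ → X) : Set X :=
  {y | MapClusterPt y atTop x}

end

/-!
Since `f₂` is positively homogeneous, its subgradients all lie in the compact set `∂f₂(0)`, on which
`f₂*` vanishes; along the serious steps `E` is therefore a continuous real function. Comparing the
minimizer `u_{l+1}` of the subproblem with its center `u_l`, and inserting the serious-step test,
sandwiches the merit value: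

  `J(u_{l+1}) + κα/2 ‖u_{l+1} - u_l‖² ≤ E(z_l) ≤ J(u_l)`.

This gives descent, and the sequence is bounded because the level sets of `J` are: truncating a
positive semidefinite matrix to its `r` largest eigenvalues leaves a matrix of rank at most `r`,
controlled by restricted isometry, and a remainder bounded by the gap between trace and Ky Fan norm,
which `J` penalizes. Finally, at `(U, W, V, T)` the vector `(0, V - U, T - α(U - V), V - U)` is a
regular subgradient of `E`: the coupling terms are quadratic, and the Fenchel inequality at `V`
bounds `f₂*` from below.
-/

noncomputable section

section Topology

variable {X : Type*}

theorem isClosed_accPts [TopologicalSpace X] (x : ℕ → X) : IsClosed (accPts x) :=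
  isClosed_setOfPred_clusterPt

variable [PseudoMetricSpace X] [ProperSpace X] {x : ℕ → X}

theorem nonempty_accPts_of_isBounded (hx : Bornology.IsBounded (Set.range x)) :
    (accPts x).Nonempty :=
  let ⟨y, _, _, hφ, hlim⟩ := tendsto_subseq_of_bounded hx Set.mem_range_self
  ⟨y, hlim.mapClusterPt.of_comp hφ.tendsto_atTop⟩

theorem isCompact_accPts_of_isBounded (hx : Bornology.IsBounded (Set.range x)) :
    IsCompact (accPts x) :=
  hx.isCompact_closure.of_isClosed_subset (isClosed_accPts x) fun _ hy =>
    isClosed_closure.mem_of_mapClusterPt hy (.of_forall fun l => subset_closure ⟨l, rfl⟩)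

end Topology

section Subdifferentials

variable {H : Type*} [NormedAddCommGroup H] [InnerProductSpace ℝ H]

theorem mem_regularSubdiff_of_quadratic_minorant {F : H → EReal} {x v : H} {a K : ℝ}
    (hx : F x = a)
    (hF : ∀ y, ((a + ⟪v, y - x⟫ - K * ‖y - x‖ ^ 2 : ℝ) : EReal) ≤ F y) :
    v ∈ regularSubdiff F x := by
  refine ⟨by simp [hx], by simp [hx], fun ε hε => ?_⟩
  have hsmall : ∀ᶠ y in 𝓝 x, K * ‖y - x‖ ≤ ε := by
    have hlim : Tendsto (fun y => K * ‖y - x‖) (𝓝 x) (𝓝 0) :=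
      Continuous.tendsto' (by fun_prop) _ _ (by simp)
    exact hlim.eventually (Iic_mem_nhds hε)
  filter_upwards [hsmall] with y hy
  rw [hx, ← EReal.coe_add]
  refine le_trans (EReal.coe_le_coe_iff.2 ?_) (hF y)
  linarith [mul_le_mul_of_nonneg_right hy (norm_nonneg (y - x))]

theorem regularSubdiff_subset_limitingSubdiff (F : H → EReal) (x : H) :
    regularSubdiff F x ⊆ limitingSubdiff F x :=
  fun v hv => ⟨hv.1, hv.2.1, fun _ => x, fun _ => v, tendsto_const_nhds, tendsto_const_nhds,
    fun _ => hv, tendsto_const_nhds⟩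

theorem isClosed_convexSubdiff (g : H → ℝ) (x : H) : IsClosed (convexSubdiff g x) := by
  simp only [convexSubdiff, Set.ofPred_forall]
  exact isClosed_iInter fun y => isClosed_le (by fun_prop) continuous_const

theorem isBounded_convexSubdiff [FiniteDimensional ℝ H] (g : H → ℝ) (x : H) :
    Bornology.IsBounded (convexSubdiff g x) := by
  let b := stdOrthonormalBasis ℝ H
  refine isBounded_iff_forall_norm_le.2
    ⟨∑ i, (|g (x + b i) - g x| + |g (x - b i) - g x|), fun v hv => ?_⟩
  have hcoord : ∀ i, |⟪b i, v⟫| ≤ |g (x + b i) - g x| + |g (x - b i) - g x| := fun i => by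
    have hplus := hv (x + b i)
    have hminus := hv (x - b i)
    rw [add_sub_cancel_left] at hplus
    rw [sub_sub_cancel_left, inner_neg_right] at hminus
    rw [real_inner_comm, abs_le]
    constructor <;>
      linarith [le_abs_self (g (x + b i) - g x), le_abs_self (g (x - b i) - g x),
        abs_nonneg (g (x + b i) - g x), abs_nonneg (g (x - b i) - g x)]
  calc ‖v‖ = ‖∑ i, ⟪b i, v⟫ • b i‖ := by rw [b.sum_repr']
    _ ≤ ∑ i, ‖⟪b i, v⟫ • b i‖ := norm_sum_le _ _
    _ = ∑ i, |⟪b i, v⟫| := by simp [norm_smul]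
    _ ≤ _ := Finset.sum_le_sum fun i _ => hcoord i

/-- Positive homogeneity of degree one, which keeps all subgradients of the subtracted term `f₂`
where its conjugate vanishes. -/
def PosHomogeneous (g : H → ℝ) : Prop :=
  ∀ t : ℝ, 0 ≤ t → ∀ x, g (t • x) = t * g x

namespace PosHomogeneous

variable {g : H → ℝ} {v x : H}

theorem map_zero (hg : PosHomogeneous g) : g 0 = 0 := by
  simpa using hg 0 le_rfl 0

theorem mem_convexSubdiff_zero_iff (hg : PosHomogeneous g) :
    v ∈ convexSubdiff g 0 ↔ ∀ y, ⟪v, y⟫ ≤ g y := by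
  simp [convexSubdiff, hg.map_zero]

theorem inner_eq_of_mem_convexSubdiff (hg : PosHomogeneous g) (hv : v ∈ convexSubdiff g x) :
    ⟪v, x⟫ = g x := by
  have hzero := hv 0
  have htwo := hv ((2 : ℝ) • x)
  rw [hg.map_zero, zero_sub, inner_neg_right] at hzero
  rw [hg 2 zero_le_two, two_smul, add_sub_cancel_right] at htwo
  linarith

theorem convexSubdiff_subset_zero (hg : PosHomogeneous g) :
    convexSubdiff g x ⊆ convexSubdiff g 0 := fun v hv => by
  refine hg.mem_convexSubdiff_zero_iff.2 fun y => ?_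
  have hy := hv y
  rw [inner_sub_right, hg.inner_eq_of_mem_convexSubdiff hv] at hy
  linarith

end PosHomogeneous

end Subdifferentials

section Merit

variable {H : Type*} [NormedAddCommGroup H]

/-- The point `(u, w, v, t)` of the Euclidean product `H⁴`; `quad` is the case `H = SymMat d`. -/
def quadruple (u w v t : H) : PiLp 2 fun _ : Fin 4 => H := WithLp.toLp 2 ![u, w, v, t]

theorem norm_quadruple_le (u w v t : H) : ‖quadruple u w v t‖ ≤ ‖u‖ + ‖w‖ + ‖v‖ + ‖t‖ := by
  have hsq : ‖quadruple u w v t‖ ^ 2 = ‖u‖ ^ 2 + ‖w‖ ^ 2 + ‖v‖ ^ 2 + ‖t‖ ^ 2 := by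
    simp [PiLp.norm_sq_eq_of_L2, Fin.sum_univ_four, quadruple]
  refine le_of_sq_le_sq ?_ (by positivity)
  have hu := norm_nonneg u
  have hw := norm_nonneg w
  have hv := norm_nonneg v
  have ht := norm_nonneg t
  nlinarith [mul_nonneg hu hw, mul_nonneg hu hv, mul_nonneg hu ht, mul_nonneg hw hv,
    mul_nonneg hw ht, mul_nonneg hv ht]

variable [InnerProductSpace ℝ H]

theorem inner_quadruple_sub_quadruple (a b c e u w v t : H) (y : PiLp 2 fun _ : Fin 4 => H) :
    ⟪quadruple a b c e, y - quadruple u w v t⟫ =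
      ⟪a, y 0 - u⟫ + ⟪b, y 1 - w⟫ + ⟪c, y 2 - v⟫ + ⟪e, y 3 - t⟫ := by
  simp [PiLp.inner_apply, Fin.sum_univ_four, quadruple]

/-- The conjugate `w ↦ sup {⟪w, u⟫ - g u | u ∈ C}` of the restriction of `g` to `C`. -/
def conjugateOn (g : H → ℝ) (C : Set H) (w : H) : EReal :=
  ⨆ u ∈ C, ((⟪w, u⟫ - g u : ℝ) : EReal)

/-- The real part of the merit function: everything except the conjugate of the subtracted term
and the domain constraint. -/
def meritReal (f : H → ℝ) (α : ℝ) (z : PiLp 2 fun _ : Fin 4 => H) : ℝ :=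
  f (z 0) - ⟪z 0, z 1⟫ + α / 2 * ‖z 0 - z 2‖ ^ 2 - ⟪z 3, z 0 - z 2⟫

open Classical in
/-- The merit function of the inexact proximal DC algorithm for minimizing `f - g` over `C`;
`auxE` is the case `f = f₁`, `g = f₂`, `C = S^d_+`. -/
def merit (f g : H → ℝ) (C : Set H) (α : ℝ) (z : PiLp 2 fun _ : Fin 4 => H) : EReal :=
  if z 0 ∈ C then (meritReal f α z : EReal) + conjugateOn g C (z 1) else ⊤

/-- The objective of the proximal subproblem with linearization `w`, center `v` and error `t`;
`subObj` is the case `f = f₁`. -/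
def proxObjective (f : H → ℝ) (α : ℝ) (w v t u : H) : ℝ :=
  f u - ⟪u, w⟫ + α / 2 * ‖u - v‖ ^ 2 - ⟪t, u⟫

variable {f g : H → ℝ} {C : Set H} {α κ : ℝ}

theorem continuous_meritReal (hf : Continuous f) : Continuous (meritReal f α) := by
  unfold meritReal
  fun_prop

theorem conjugateOn_eq_zero (hg : PosHomogeneous g) (h0 : 0 ∈ C) {w : H}
    (hw : w ∈ convexSubdiff g 0) : conjugateOn g C w = 0 := by
  refine le_antisymm (iSup₂_le fun y _ => ?_) (le_iSup₂_of_le 0 h0 ?_)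
  · exact_mod_cast sub_nonpos.2 (hg.mem_convexSubdiff_zero_iff.1 hw y)
  · simp [hg.map_zero]

theorem merit_eq_coe_meritReal (hg : PosHomogeneous g) (h0 : 0 ∈ C)
    {z : PiLp 2 fun _ : Fin 4 => H} (hz0 : z 0 ∈ C) (hz1 : z 1 ∈ convexSubdiff g 0) :
    merit f g C α z = (meritReal f α z : EReal) := by
  rw [merit, if_pos hz0, conjugateOn_eq_zero hg h0 hz1, add_zero]

theorem coe_meritReal_add_le_merit {z : PiLp 2 fun _ : Fin 4 => H} {v : H} (hv : v ∈ C) :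
    ((meritReal f α z + (⟪z 1, v⟫ - g v) : ℝ) : EReal) ≤ merit f g C α z := by
  unfold merit
  split_ifs
  · rw [EReal.coe_add]
    exact add_le_add_right
      (le_iSup₂ (f := fun u (_ : u ∈ C) => ((⟪z 1, u⟫ - g u : ℝ) : EReal)) v hv) _
  · exact le_top

theorem sub_add_le_meritReal {u w v t : H} (hw : ⟪w, u⟫ ≤ g u)
    (ht : ‖t‖ ≤ (1 - κ) * α / 2 * ‖u - v‖) :
    f u - g u + κ * α / 2 * ‖u - v‖ ^ 2 ≤ meritReal f α (quadruple u w v t) := by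
  have herror : ⟪t, u - v⟫ ≤ (1 - κ) * α / 2 * ‖u - v‖ ^ 2 :=
    calc ⟪t, u - v⟫ ≤ ‖t‖ * ‖u - v‖ := real_inner_le_norm _ _
      _ ≤ (1 - κ) * α / 2 * ‖u - v‖ * ‖u - v‖ := by gcongr
      _ = _ := by ring
  change _ ≤ f u - ⟪u, w⟫ + α / 2 * ‖u - v‖ ^ 2 - ⟪t, u - v⟫
  rw [real_inner_comm]
  linarith

theorem meritReal_le_sub {u w v t : H} (hv : v ∈ C) (hw : ⟪w, v⟫ = g v)
    (hmin : IsMinOn (proxObjective f α w v t) C u) :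
    meritReal f α (quadruple u w v t) ≤ f v - g v := by
  have hle : proxObjective f α w v t u ≤ proxObjective f α w v t v := hmin hv
  simp only [proxObjective, sub_self, norm_zero, real_inner_comm w v, hw] at hle
  change f u - ⟪u, w⟫ + α / 2 * ‖u - v‖ ^ 2 - ⟪t, u - v⟫ ≤ _
  rw [inner_sub_right]
  linarith

theorem add_inner_sub_le_of_isMinOn_proxObjective {u w v t y : H} (hy : y ∈ C)
    (hmin : IsMinOn (proxObjective f α w v t) C u) :
    f u + ⟪w + t - α • (u - v), y - u⟫ - α / 2 * ‖y - u‖ ^ 2 ≤ f y := by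
  have hle : proxObjective f α w v t u ≤ proxObjective f α w v t y := hmin hy
  have hsq : ‖y - v‖ ^ 2 = ‖y - u‖ ^ 2 + 2 * ⟪u - v, y - u⟫ + ‖u - v‖ ^ 2 := by
    rw [← sub_add_sub_cancel y u v, norm_add_sq_real, real_inner_comm]
  simp only [proxObjective, hsq] at hle
  simp only [inner_sub_left (w + t), inner_add_left, real_inner_smul_left]
  simp only [inner_sub_right w, inner_sub_right t, real_inner_comm y w, real_inner_comm u w]
  linarith

-- Apart from `f` the function is a quadratic form, so the remainder of its first-order expansion
-- is its value at the increment.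
theorem meritReal_eq_add_inner_add (u w v t : H) (y : PiLp 2 fun _ : Fin 4 => H) :
    meritReal f α y = meritReal f α (quadruple u w v t) + (f (y 0) - f u) +
      ⟪quadruple (α • (u - v) - w - t) (-u) (t - α • (u - v)) (v - u), y - quadruple u w v t⟫ +
      meritReal 0 α (y - quadruple u w v t) := by
  rw [inner_quadruple_sub_quadruple]
  change f (y 0) - ⟪y 0, y 1⟫ + α / 2 * ‖y 0 - y 2‖ ^ 2 - ⟪y 3, y 0 - y 2⟫ =
    f u - ⟪u, w⟫ + α / 2 * ‖u - v‖ ^ 2 - ⟪t, u - v⟫ + (f (y 0) - f u) + _ +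
    (0 - ⟪y 0 - u, y 1 - w⟫ + α / 2 * ‖y 0 - u - (y 2 - v)‖ ^ 2 -
      ⟪y 3 - t, y 0 - u - (y 2 - v)⟫)
  simp only [← real_inner_self_eq_norm_sq, inner_sub_left, inner_sub_right, inner_neg_left,
    real_inner_smul_left]
  simp only [real_inner_comm]
  ring

theorem neg_three_mul_norm_sq_le_meritReal_zero (hα : 0 ≤ α) (z : PiLp 2 fun _ : Fin 4 => H) :
    -(3 * ‖z‖ ^ 2) ≤ meritReal 0 α z := by
  have hinner : ∀ i j : Fin 4, |⟪z i, z j⟫| ≤ ‖z‖ ^ 2 := fun i j =>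
    calc |⟪z i, z j⟫| ≤ ‖z i‖ * ‖z j‖ := abs_real_inner_le_norm _ _
      _ ≤ ‖z‖ * ‖z‖ := by gcongr <;> exact PiLp.norm_apply_le z _
      _ = ‖z‖ ^ 2 := (sq _).symm
  have hprox : 0 ≤ α / 2 * ‖z 0 - z 2‖ ^ 2 := by positivity
  rw [meritReal, Pi.zero_apply, inner_sub_right]
  linarith [abs_le.1 (hinner 0 1), abs_le.1 (hinner 3 0), abs_le.1 (hinner 3 2)]

theorem mem_regularSubdiff_merit (hα : 0 ≤ α) (hg : PosHomogeneous g) (h0 : 0 ∈ C)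
    {u w v t : H} (hu : u ∈ C) (hv : v ∈ C) (hw : w ∈ convexSubdiff g v)
    (hmin : IsMinOn (proxObjective f α w v t) C u) :
    quadruple 0 (v - u) (t - α • (u - v)) (v - u) ∈
      regularSubdiff (merit f g C α) (quadruple u w v t) := by
  have hfinite : merit f g C α (quadruple u w v t) = (meritReal f α (quadruple u w v t) : EReal) :=
    merit_eq_coe_meritReal hg h0 hu (hg.convexSubdiff_subset_zero hw)
  refine mem_regularSubdiff_of_quadratic_minorant (K := 3 + α / 2) hfinite fun y => ?_
  by_cases hy : y 0 ∈ C
  swap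
  · rw [merit, if_neg hy]; exact le_top
  refine le_trans (EReal.coe_le_coe_iff.2 ?_) (coe_meritReal_add_le_merit hv)
  have hgrowth := add_inner_sub_le_of_isMinOn_proxObjective hy hmin
  have hrem := neg_three_mul_norm_sq_le_meritReal_zero hα (y - quadruple u w v t)
  have hnorm : α / 2 * ‖y 0 - u‖ ^ 2 ≤ α / 2 * ‖y - quadruple u w v t‖ ^ 2 := by
    gcongr
    exact PiLp.norm_apply_le (y - quadruple u w v t) 0
  have hfenchel : ⟪y 1, v⟫ - g v = ⟪v, y 1 - w⟫ := by
    rw [← hg.inner_eq_of_mem_convexSubdiff hw, ← inner_sub_left, real_inner_comm]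
  rw [meritReal_eq_add_inner_add u w v t y, hfenchel]
  simp only [inner_quadruple_sub_quadruple, inner_sub_left, inner_add_left, inner_neg_left,
    inner_zero_left] at hgrowth ⊢
  linarith

end Merit

section SeriousSequence

variable {H : Type*} [NormedAddCommGroup H]

/-- The point `z_l = (u_{l+1}, w_l, u_l, e_{l+1})` at which the merit function is evaluated after
the `l`-th serious step; `seriousQuad` is the case `H = SymMat d`. -/
def stepPoint (u w e : ℕ → H) (l : ℕ) : PiLp 2 fun _ : Fin 4 => H :=
  quadruple (u (l + 1)) (w l) (u l) (e (l + 1))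

variable [InnerProductSpace ℝ H]

/-- The serious steps of an inexact proximal DC algorithm for minimizing `f - g` over `C`: centers
`u`, subgradients `w` of `g` and errors `e`, where `e (l + 1)` is the error of the subproblem
solved by `u (l + 1)`, and `e 0` is a junk value. -/
structure IsInexactProxDCSeq (f g : H → ℝ) (C : Set H) (α κ : ℝ) (u w e : ℕ → H) : Prop where
  mem : ∀ l, u l ∈ C
  subgrad : ∀ l, w l ∈ convexSubdiff g (u l)
  isMinOn : ∀ l, IsMinOn (proxObjective f α (w l) (u l) (e (l + 1))) C (u (l + 1))
  norm_error_le : ∀ l, ‖e (l + 1)‖ ≤ (1 - κ) * α / 2 * ‖u (l + 1) - u l‖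

namespace IsInexactProxDCSeq

variable {f g : H → ℝ} {C : Set H} {α κ : ℝ} {u w e : ℕ → H}

theorem merit_stepPoint (h : IsInexactProxDCSeq f g C α κ u w e) (hg : PosHomogeneous g)
    (h0 : 0 ∈ C) (l : ℕ) :
    merit f g C α (stepPoint u w e l) = (meritReal f α (stepPoint u w e l) : EReal) :=
  merit_eq_coe_meritReal hg h0 (h.mem (l + 1)) (hg.convexSubdiff_subset_zero (h.subgrad l))

theorem sub_add_le_meritReal_stepPoint (h : IsInexactProxDCSeq f g C α κ u w e)
    (hg : PosHomogeneous g) (l : ℕ) :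
    f (u (l + 1)) - g (u (l + 1)) + κ * α / 2 * ‖u (l + 1) - u l‖ ^ 2 ≤
      meritReal f α (stepPoint u w e l) :=
  sub_add_le_meritReal
    (hg.mem_convexSubdiff_zero_iff.1 (hg.convexSubdiff_subset_zero (h.subgrad l)) _)
    (h.norm_error_le l)

theorem meritReal_stepPoint_le_sub (h : IsInexactProxDCSeq f g C α κ u w e)
    (hg : PosHomogeneous g) (l : ℕ) :
    meritReal f α (stepPoint u w e l) ≤ f (u l) - g (u l) :=
  meritReal_le_sub (h.mem l) (hg.inner_eq_of_mem_convexSubdiff (h.subgrad l)) (h.isMinOn l)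

theorem meritReal_stepPoint_succ_le (h : IsInexactProxDCSeq f g C α κ u w e)
    (hg : PosHomogeneous g) (l : ℕ) :
    meritReal f α (stepPoint u w e (l + 1)) ≤
      meritReal f α (stepPoint u w e l) - κ * α / 2 * ‖u (l + 1) - u l‖ ^ 2 :=
  (h.meritReal_stepPoint_le_sub hg (l + 1)).trans
    (le_sub_iff_add_le.2 (h.sub_add_le_meritReal_stepPoint hg l))

theorem sub_le_meritReal_stepPoint (h : IsInexactProxDCSeq f g C α κ u w e)
    (hg : PosHomogeneous g) (hα : 0 ≤ α) (hκ : 0 ≤ κ) (l : ℕ) :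
    f (u (l + 1)) - g (u (l + 1)) ≤ meritReal f α (stepPoint u w e l) :=
  (le_add_of_nonneg_right (by positivity)).trans (h.sub_add_le_meritReal_stepPoint hg l)

theorem antitone_meritReal_stepPoint (h : IsInexactProxDCSeq f g C α κ u w e)
    (hg : PosHomogeneous g) (hα : 0 ≤ α) (hκ : 0 ≤ κ) :
    Antitone fun l => meritReal f α (stepPoint u w e l) :=
  antitone_nat_of_succ_le fun l =>
    (h.meritReal_stepPoint_succ_le hg l).trans (sub_le_self _ (by positivity))

theorem antitone_objective (h : IsInexactProxDCSeq f g C α κ u w e)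
    (hg : PosHomogeneous g) (hα : 0 ≤ α) (hκ : 0 ≤ κ) :
    Antitone fun l => f (u l) - g (u l) :=
  antitone_nat_of_succ_le fun l =>
    (h.sub_le_meritReal_stepPoint hg hα hκ l).trans (h.meritReal_stepPoint_le_sub hg l)

theorem norm_error_le_of_norm_le (h : IsInexactProxDCSeq f g C α κ u w e) (hα : 0 ≤ α)
    (hκ : 0 ≤ κ) {K : ℝ} (hK : ∀ l, ‖u l‖ ≤ K) (l : ℕ) : ‖e (l + 1)‖ ≤ α * K := by
  have hfactor : (1 - κ) * α / 2 ≤ α / 2 := by linarith [mul_nonneg hκ hα]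
  calc ‖e (l + 1)‖ ≤ (1 - κ) * α / 2 * ‖u (l + 1) - u l‖ := h.norm_error_le l
    _ ≤ α / 2 * (K + K) :=
      mul_le_mul hfactor ((norm_sub_le _ _).trans (add_le_add (hK _) (hK _))) (norm_nonneg _)
        (by positivity)
    _ = α * K := by ring

theorem isBounded_range_stepPoint [FiniteDimensional ℝ H]
    (h : IsInexactProxDCSeq f g C α κ u w e) (hg : PosHomogeneous g) (hα : 0 ≤ α) (hκ : 0 ≤ κ)
    (hlevel : ∀ M, Bornology.IsBounded {x ∈ C | f x - g x ≤ M}) :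
    Bornology.IsBounded (Set.range (stepPoint u w e)) := by
  obtain ⟨K, hK⟩ := (hlevel (f (u 0) - g (u 0))).exists_norm_le
  obtain ⟨L, hL⟩ := (isBounded_convexSubdiff g 0).exists_norm_le
  have hu : ∀ l, ‖u l‖ ≤ K := fun l =>
    hK _ ⟨h.mem l, h.antitone_objective hg hα hκ (Nat.zero_le l)⟩
  have hw : ∀ l, ‖w l‖ ≤ L := fun l => hL _ (hg.convexSubdiff_subset_zero (h.subgrad l))
  refine isBounded_iff_forall_norm_le.2 ⟨K + L + K + α * K, Set.forall_mem_range.2 fun l => ?_⟩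
  refine (norm_quadruple_le _ _ _ _).trans ?_
  linarith [hu l, hu (l + 1), hw l, h.norm_error_le_of_norm_le hα hκ hu l]

theorem exists_tendsto_meritReal_stepPoint [FiniteDimensional ℝ H]
    (h : IsInexactProxDCSeq f g C α κ u w e) (hg : PosHomogeneous g) (hf : Continuous f)
    (hα : 0 ≤ α) (hκ : 0 ≤ κ) (hlevel : ∀ M, Bornology.IsBounded {x ∈ C | f x - g x ≤ M}) :
    ∃ Υ, Tendsto (fun l => meritReal f α (stepPoint u w e l)) atTop (𝓝 Υ) := by
  have : ProperSpace (PiLp 2 fun _ : Fin 4 => H) := FiniteDimensional.proper_real _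
  obtain ⟨m, hm⟩ := (h.isBounded_range_stepPoint hg hα hκ hlevel).isCompact_closure.bddBelow_image
    (continuous_meritReal (α := α) hf).continuousOn
  refine ⟨_, tendsto_atTop_ciInf (h.antitone_meritReal_stepPoint hg hα hκ) ⟨m, ?_⟩⟩
  rintro _ ⟨l, rfl⟩
  exact hm ⟨_, subset_closure ⟨l, rfl⟩, rfl⟩

theorem merit_eq_of_mem_accPts (h : IsInexactProxDCSeq f g C α κ u w e) (hg : PosHomogeneous g)
    (hf : Continuous f) (hC : IsClosed C) (h0 : 0 ∈ C) {Υ : ℝ}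
    (hΥ : Tendsto (fun l => meritReal f α (stepPoint u w e l)) atTop (𝓝 Υ))
    {z : PiLp 2 fun _ : Fin 4 => H} (hz : z ∈ accPts (stepPoint u w e)) :
    merit f g C α z = Υ := by
  obtain ⟨φ, hφ, hlim⟩ := MapClusterPt.tendsto_subseq hz
  have hcoord : ∀ i, Tendsto (fun m => stepPoint u w e (φ m) i) atTop (𝓝 (z i)) := fun i =>
    ((PiLp.continuous_apply 2 _ i).tendsto z).comp hlim
  have hz0 : z 0 ∈ C := hC.mem_of_tendsto (hcoord 0) (.of_forall fun m => h.mem (φ m + 1))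
  have hz1 : z 1 ∈ convexSubdiff g 0 := (isClosed_convexSubdiff g 0).mem_of_tendsto (hcoord 1)
    (.of_forall fun m => hg.convexSubdiff_subset_zero (h.subgrad (φ m)))
  rw [merit_eq_coe_meritReal hg h0 hz0 hz1,
    tendsto_nhds_unique (((continuous_meritReal hf).tendsto z).comp hlim)
      (hΥ.comp hφ.tendsto_atTop)]

theorem infEDist_limitingSubdiff_merit_le (h : IsInexactProxDCSeq f g C α κ u w e)
    (hg : PosHomogeneous g) (h0 : 0 ∈ C) (hα : 0 ≤ α) (hκ : 0 ≤ κ) (l : ℕ) :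
    Metric.infEDist 0 (limitingSubdiff (merit f g C α) (stepPoint u w e l)) ≤
      ENNReal.ofReal ((2 + 2 * α) * ‖u (l + 1) - u l‖) := by
  have hmem := regularSubdiff_subset_limitingSubdiff _ _ <| mem_regularSubdiff_merit hα hg h0
    (h.mem (l + 1)) (h.mem l) (h.subgrad l) (h.isMinOn l)
  refine (Metric.infEDist_le_edist_of_mem hmem).trans ?_
  rw [edist_dist, dist_zero_left]
  refine ENNReal.ofReal_le_ofReal ((norm_quadruple_le _ _ _ _).trans ?_)
  have herror := h.norm_error_le l
  have hprox := norm_sub_le (e (l + 1)) (α • (u (l + 1) - u l))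
  rw [norm_smul, Real.norm_of_nonneg hα] at hprox
  rw [norm_zero, norm_sub_rev (u l)]
  nlinarith [mul_nonneg (mul_nonneg hκ hα) (norm_nonneg (u (l + 1) - u l)),
    mul_nonneg hα (norm_nonneg (u (l + 1) - u l))]

end IsInexactProxDCSeq

theorem proposition6_general [FiniteDimensional ℝ H] {f g : H → ℝ} {C : Set H} {α κ : ℝ}
    {u w e : ℕ → H} (hf : Continuous f) (hg : PosHomogeneous g) (hC : IsClosed C) (h0 : 0 ∈ C)
    (hlevel : ∀ M, Bornology.IsBounded {x ∈ C | f x - g x ≤ M}) (hα : 0 ≤ α) (hκ : 0 ≤ κ)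
    (h : IsInexactProxDCSeq f g C α κ u w e) :
    (∀ l, merit f g C α (stepPoint u w e l) ≠ ⊤ ∧ merit f g C α (stepPoint u w e l) ≠ ⊥) ∧
    (∀ l, ((f (u (l + 1)) - g (u (l + 1)) : ℝ) : EReal) ≤ merit f g C α (stepPoint u w e l)) ∧
    (∀ l, merit f g C α (stepPoint u w e (l + 1)) ≤
      merit f g C α (stepPoint u w e l) - ((κ * α / 2 * ‖u (l + 1) - u l‖ ^ 2 : ℝ) : EReal)) ∧
    ((accPts (stepPoint u w e)).Nonempty ∧ IsCompact (accPts (stepPoint u w e))) ∧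
    (∃ Υ : ℝ, Tendsto (fun l => merit f g C α (stepPoint u w e l)) atTop (𝓝 (Υ : EReal)) ∧
      ∀ z ∈ accPts (stepPoint u w e), merit f g C α z = (Υ : EReal)) ∧
    (∃ ρ : ℝ, 0 < ρ ∧ ∀ l,
      Metric.infEDist 0 (limitingSubdiff (merit f g C α) (stepPoint u w e l)) ≤
        ENNReal.ofReal (ρ * ‖u (l + 1) - u l‖)) := by
  have : ProperSpace (PiLp 2 fun _ : Fin 4 => H) := FiniteDimensional.proper_real _
  have hbdd := h.isBounded_range_stepPoint hg hα hκ hlevel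
  obtain ⟨Υ, hΥ⟩ := h.exists_tendsto_meritReal_stepPoint hg hf hα hκ hlevel
  have hfinite := h.merit_stepPoint hg h0
  refine ⟨fun l => ?_, fun l => ?_, fun l => ?_,
    ⟨nonempty_accPts_of_isBounded hbdd, isCompact_accPts_of_isBounded hbdd⟩,
    ⟨Υ, ?_, fun z hz => h.merit_eq_of_mem_accPts hg hf hC h0 hΥ hz⟩,
    2 + 2 * α, by positivity, h.infEDist_limitingSubdiff_merit_le hg h0 hα hκ⟩
  · simp [hfinite]
  · rw [hfinite, EReal.coe_le_coe_iff]
    exact h.sub_le_meritReal_stepPoint hg hα hκ l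
  · rw [hfinite, hfinite, ← EReal.coe_sub, EReal.coe_le_coe_iff]
    exact h.meritReal_stepPoint_succ_le hg l
  · simp only [hfinite]
    exact (continuous_coe_real_ereal.tendsto Υ).comp hΥ

end SeriousSequence

section SingularValues

variable {𝕜 E F : Type*} [RCLike 𝕜] [NormedAddCommGroup E] [InnerProductSpace 𝕜 E]
  [FiniteDimensional 𝕜 E] [NormedAddCommGroup F] [InnerProductSpace 𝕜 F] [FiniteDimensional 𝕜 F]
  {n : ℕ}

theorem eigenvalues_eq_of_basis {S : E →ₗ[𝕜] E} (hS : S.IsSymmetric)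
    (hn : Module.finrank 𝕜 E = n) (b : Module.Basis (Fin n) 𝕜 E) {μ : Fin n → ℝ}
    (hμ : Antitone μ) (hb : ∀ i, S (b i) = (μ i : 𝕜) • b i) : hS.eigenvalues hn = μ := by
  have hdiag : S.toMatrix b b = Matrix.diagonal fun i => (μ i : 𝕜) := by
    ext i j
    rcases eq_or_ne i j with rfl | hij
    · simp [LinearMap.toMatrix_apply, hb, RCLike.real_smul_eq_coe_mul]
    · simp [LinearMap.toMatrix_apply, hb, hij]
  have hroots : S.charpoly.roots = Multiset.map (fun i => (μ i : 𝕜)) Finset.univ.val := by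
    rw [← LinearMap.charpoly_toMatrix S b, hdiag, Matrix.charpoly_diagonal,
      Polynomial.roots_prod _ _ (Finset.prod_ne_zero_iff.2 fun i _ => Polynomial.X_sub_C_ne_zero _)]
    simp [Multiset.bind_singleton]
  rw [← List.ofFn_inj, ← hS.sort_roots_charpoly_eq_eigenvalues hn, hroots, Fin.univ_val_map,
    Multiset.map_coe, Multiset.coe_sort]
  simp only [List.map_ofFn, Function.comp_def, RCLike.ofReal_re]
  refine List.mergeSort_of_pairwise ?_
  simp_rw [decide_eq_true_eq, ← List.sortedGE_iff_pairwise]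
  exact hμ.sortedGE_ofFn

theorem singularValues_eq_of_basis (T : E →ₗ[𝕜] F) (b : Module.Basis (Fin n) 𝕜 E) {σ : Fin n → ℝ}
    (hσ : Antitone σ) (hσ0 : ∀ i, 0 ≤ σ i)
    (hb : ∀ i, LinearMap.adjoint T (T (b i)) = ((σ i ^ 2 : ℝ) : 𝕜) • b i) (i : Fin n) :
    T.singularValues i = σ i := by
  have hn : Module.finrank 𝕜 E = n := by simp [Module.finrank_eq_card_basis b]
  have hσ2 : Antitone fun i => σ i ^ 2 := fun i j hij => pow_le_pow_left₀ (hσ0 j) (hσ hij) 2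
  rw [T.singularValues_fin hn,
    eigenvalues_eq_of_basis T.isSymmetric_adjoint_comp_self hn b hσ2 hb, Real.sqrt_sq (hσ0 i)]

theorem adjoint_apply_apply_eigenvectorBasis (T : E →ₗ[𝕜] F) (hn : Module.finrank 𝕜 E = n)
    (i : Fin n) :
    LinearMap.adjoint T (T (T.isSymmetric_adjoint_comp_self.eigenvectorBasis hn i)) =
      ((T.singularValues i ^ 2 : ℝ) : 𝕜) •
        T.isSymmetric_adjoint_comp_self.eigenvectorBasis hn i := by
  rw [T.sq_singularValues_fin hn]
  exact T.isSymmetric_adjoint_comp_self.apply_eigenvectorBasis hn i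

theorem singularValues_smul (t : 𝕜) (T : E →ₗ[𝕜] F) (i : ℕ) :
    (t • T).singularValues i = ‖t‖ * T.singularValues i := by
  obtain hi | hi := lt_or_ge i (Module.finrank 𝕜 E)
  · refine singularValues_eq_of_basis (t • T)
      (T.isSymmetric_adjoint_comp_self.eigenvectorBasis rfl).toBasis
      (σ := fun j => ‖t‖ * T.singularValues j)
      (fun j k hjk => mul_le_mul_of_nonneg_left (T.singularValues_antitone hjk) (norm_nonneg t))
      (fun j => mul_nonneg (norm_nonneg t) (T.singularValues_nonneg j)) (fun j => ?_) ⟨i, hi⟩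
    rw [OrthonormalBasis.coe_toBasis, map_smulₛₗ, LinearMap.smul_apply, LinearMap.smul_apply,
      map_smul, adjoint_apply_apply_eigenvectorBasis T rfl j, smul_smul, smul_smul,
      RCLike.conj_mul, mul_pow, RCLike.ofReal_mul, RCLike.ofReal_pow ‖t‖]
  · simp [LinearMap.singularValues_of_finrank_le _ hi]

theorem singularValues_eq_eigenvalues {T : E →ₗ[𝕜] E} (hT : T.IsPositive)
    (hn : Module.finrank 𝕜 E = n) (i : Fin n) :
    T.singularValues i = hT.isSymmetric.eigenvalues hn i := by
  refine singularValues_eq_of_basis T (hT.isSymmetric.eigenvectorBasis hn).toBasis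
    (hT.isSymmetric.eigenvalues_antitone hn) (hT.nonneg_eigenvalues hn) (fun j => ?_) i
  rw [hT.isSymmetric.adjoint_eq, OrthonormalBasis.coe_toBasis,
    hT.isSymmetric.apply_eigenvectorBasis, map_smul, hT.isSymmetric.apply_eigenvectorBasis,
    smul_smul, RCLike.ofReal_pow, pow_two]

theorem sum_range_singularValues_eq_sum_filter (T : E →ₗ[𝕜] F) (hn : Module.finrank 𝕜 E = n)
    (r : ℕ) :
    ∑ i ∈ Finset.range r, T.singularValues i =
      ∑ i ∈ {j : Fin n | (j : ℕ) < r}, T.singularValues i := by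
  calc ∑ i ∈ Finset.range r, T.singularValues i
      = ∑ i ∈ Finset.range n with i < r, T.singularValues i := by
        refine (Finset.sum_subset (fun i hi => ?_) fun i hir hin => ?_).symm
        · exact Finset.mem_range.2 (Finset.mem_filter.1 hi).2
        · exact T.singularValues_of_finrank_le (by simp_all)
    _ = ∑ i ∈ {j : Fin n | (j : ℕ) < r}, T.singularValues i := by
        rw [Finset.sum_filter, Finset.sum_filter, ← Fin.sum_univ_eq_sum_range]

end SingularValues

namespace SymMat

variable {d : ℕ}

theorem norm_sq_eq (U : SymMat d) : ‖U‖ ^ 2 = ∑ i, ∑ j, toMat U i j ^ 2 := by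
  rw [← real_inner_self_eq_norm_sq, inner_eq]
  simp only [pow_two]

/-- The rank-one symmetric matrix `x xᵀ`, from which spectral decompositions are built. -/
def outer (x : EuclideanSpace ℝ (Fin d)) : SymMat d :=
  ⟨Matrix.vecMulVec x x, by ext i j; simp [Matrix.vecMulVec_apply, mul_comm]⟩

theorem toMat_outer (x : EuclideanSpace ℝ (Fin d)) : toMat (outer x) = Matrix.vecMulVec x x := rfl

theorem norm_outer (x : EuclideanSpace ℝ (Fin d)) : ‖outer x‖ = ‖x‖ ^ 2 := by
  refine (sq_eq_sq₀ (norm_nonneg _) (by positivity)).1 ?_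
  rw [norm_sq_eq, EuclideanSpace.norm_sq_eq, pow_two, Finset.sum_mul_sum]
  simp [toMat_outer, Matrix.vecMulVec_apply, mul_pow]

theorem inner_outer_ident (x : EuclideanSpace ℝ (Fin d)) : ⟪outer x, ident d⟫ = ‖x‖ ^ 2 := by
  rw [EuclideanSpace.norm_sq_eq]
  simp [inner_eq, toMat_ident, toMat_outer, Matrix.vecMulVec_apply, Matrix.one_apply, pow_two]

theorem toEuclideanLin_outer (x y : EuclideanSpace ℝ (Fin d)) :
    Matrix.toEuclideanLin (toMat (outer x)) y = ⟪x, y⟫ • x := by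
  ext i
  simp [toMat_outer, Matrix.vecMulVec_mulVec, PiLp.inner_apply, dotProduct, mul_comm]

theorem toEuclideanLin_sum_smul_outer {ι : Type*} (s : Finset ι) (a : ι → ℝ)
    (x : ι → EuclideanSpace ℝ (Fin d)) (y : EuclideanSpace ℝ (Fin d)) :
    Matrix.toEuclideanLin (toMat (∑ i ∈ s, a i • outer (x i))) y =
      ∑ i ∈ s, (a i * ⟪x i, y⟫) • x i := by
  simp only [map_sum, map_smul, LinearMap.sum_apply, LinearMap.smul_apply, toEuclideanLin_outer,
    smul_smul]

theorem outer_mem_psdCone (x : EuclideanSpace ℝ (Fin d)) : outer x ∈ psdCone d :=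
  Matrix.posSemidef_vecMulVec_self_star (x : Fin d → ℝ)

theorem sum_smul_outer_mem_psdCone {ι : Type*} (s : Finset ι) {a : ι → ℝ} (ha : ∀ i, 0 ≤ a i)
    (x : ι → EuclideanSpace ℝ (Fin d)) : ∑ i ∈ s, a i • outer (x i) ∈ psdCone d := by
  simp only [psdCone, Set.mem_ofPred_eq, map_sum, map_smul]
  exact Matrix.posSemidef_sum s fun i _ => (outer_mem_psdCone (x i)).smul (ha i)

theorem rank_sum_smul_outer_le {ι : Type*} (s : Finset ι) (a : ι → ℝ)
    (x : ι → EuclideanSpace ℝ (Fin d)) :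
    (toMat (∑ i ∈ s, a i • outer (x i))).rank ≤ s.card := by
  classical
  set X := toMat (∑ i ∈ s, a i • outer (x i))
  have hrange : (Matrix.toEuclideanLin X).range ≤
      Submodule.span ℝ (s.image x : Set (EuclideanSpace ℝ (Fin d))) := by
    rintro _ ⟨y, rfl⟩
    rw [toEuclideanLin_sum_smul_outer]
    exact Submodule.sum_mem _ fun i hi => Submodule.smul_mem _ _
      (Submodule.subset_span (Finset.mem_coe.2 (Finset.mem_image_of_mem x hi)))
  calc X.rank = Module.finrank ℝ (Matrix.toEuclideanLin X).range :=
        Matrix.rank_eq_finrank_range_toLin X (EuclideanSpace.basisFun _ ℝ).toBasis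
          (EuclideanSpace.basisFun _ ℝ).toBasis
    _ ≤ Module.finrank ℝ _ := Submodule.finrank_mono hrange
    _ ≤ (s.image x).card := finrank_span_finset_le_card _
    _ ≤ s.card := Finset.card_image_le

theorem norm_sum_smul_outer_le {ι : Type*} (s : Finset ι) {a : ι → ℝ} (ha : ∀ i, 0 ≤ a i)
    {x : ι → EuclideanSpace ℝ (Fin d)} (hx : ∀ i, ‖x i‖ = 1) :
    ‖∑ i ∈ s, a i • outer (x i)‖ ≤ ∑ i ∈ s, a i :=
  norm_sum_le_of_le _ fun i _ => by
    rw [norm_smul, norm_outer, hx, Real.norm_of_nonneg (ha i), one_pow, mul_one]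

theorem inner_sum_smul_outer_ident {ι : Type*} (s : Finset ι) (a : ι → ℝ)
    {x : ι → EuclideanSpace ℝ (Fin d)} (hx : ∀ i, ‖x i‖ = 1) :
    ⟪∑ i ∈ s, a i • outer (x i), ident d⟫ = ∑ i ∈ s, a i := by
  simp only [sum_inner, real_inner_smul_left, inner_outer_ident, hx, one_pow, mul_one]

theorem exists_eq_sum_singularValues_smul_outer {U : SymMat d} (hU : U ∈ psdCone d) :
    ∃ b : OrthonormalBasis (Fin d) ℝ (EuclideanSpace ℝ (Fin d)),
      U = ∑ i : Fin d, (Matrix.toEuclideanLin (toMat U)).singularValues i • outer (b i) := by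
  have hT := Matrix.isPositive_toEuclideanLin_iff.2 hU
  have hn := finrank_euclideanSpace_fin (𝕜 := ℝ) (n := d)
  obtain ⟨b, hb⟩ : ∃ b : OrthonormalBasis (Fin d) ℝ (EuclideanSpace ℝ (Fin d)), ∀ i,
      Matrix.toEuclideanLin (toMat U) (b i) =
        (Matrix.toEuclideanLin (toMat U)).singularValues i • b i :=
    ⟨hT.isSymmetric.eigenvectorBasis hn, fun i => by
      rw [singularValues_eq_eigenvalues hT hn, hT.isSymmetric.apply_eigenvectorBasis hn]
      rfl⟩
  refine ⟨b, toMat_injective (Matrix.toEuclideanLin.injective (b.toBasis.ext fun i => ?_))⟩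
  rw [b.coe_toBasis, toEuclideanLin_sum_smul_outer, hb]
  simp [b.inner_eq_ite]

/-- Truncating the spectrum of `U` after the `r` largest eigenvalues leaves a remainder whose trace
is the gap between the trace and the Ky Fan norm. -/
theorem exists_rank_le_norm_sub_le {U : SymMat d} (hU : U ∈ psdCone d) (r : ℕ) :
    ∃ X ∈ psdCone d, (toMat X).rank ≤ r ∧ ‖U - X‖ ≤ ⟪U, ident d⟫ - kyFan r U := by
  obtain ⟨b, hb⟩ := exists_eq_sum_singularValues_smul_outer hU
  set σ := (Matrix.toEuclideanLin (toMat U)).singularValues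
  have hσ : ∀ i : Fin d, 0 ≤ σ i := fun i => LinearMap.singularValues_nonneg _ i
  have hb1 : ∀ i, ‖b i‖ = 1 := b.norm_eq_one
  refine ⟨∑ i ∈ {j : Fin d | (j : ℕ) < r}, σ i • outer (b i),
    sum_smul_outer_mem_psdCone _ hσ _, ?_, ?_⟩
  · refine (rank_sum_smul_outer_le _ _ _).trans ?_
    rw [Fin.card_filter_val_lt]
    exact min_le_right _ _
  · have htail : U - ∑ i ∈ {j : Fin d | (j : ℕ) < r}, σ i • outer (b i) =
        ∑ i ∈ {j : Fin d | ¬ (j : ℕ) < r}, σ i • outer (b i) := by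
      rw [sub_eq_iff_eq_add', Finset.sum_filter_add_sum_filter_not]
      exact hb
    have htrace : ⟪U, ident d⟫ = ∑ i : Fin d, σ i :=
      (congrArg (⟪·, ident d⟫) hb).trans (inner_sum_smul_outer_ident _ _ hb1)
    have hkyFan : kyFan r U = ∑ i ∈ {j : Fin d | (j : ℕ) < r}, σ i :=
      sum_range_singularValues_eq_sum_filter _ finrank_euclideanSpace_fin r
    have hgap : ⟪U, ident d⟫ - kyFan r U = ∑ i ∈ {j : Fin d | ¬ (j : ℕ) < r}, σ i := by
      rw [htrace, hkyFan, sub_eq_iff_eq_add', Finset.sum_filter_add_sum_filter_not]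
    rw [htail, hgap]
    exact norm_sum_smul_outer_le _ hσ hb1

theorem kyFan_le_inner_ident {U : SymMat d} (hU : U ∈ psdCone d) (r : ℕ) :
    kyFan r U ≤ ⟪U, ident d⟫ := by
  obtain ⟨X, -, -, hUX⟩ := exists_rank_le_norm_sub_le hU r
  exact sub_nonneg.1 ((norm_nonneg _).trans hUX)

end SymMat

section PenalizedLeastSquares

variable {d p : ℕ}

theorem zero_mem_psdCone : (0 : SymMat d) ∈ psdCone d := by
  simpa only [psdCone, Set.mem_ofPred_eq, map_zero] using Matrix.PosSemidef.zero

theorem isClosed_psdCone (d : ℕ) : IsClosed (psdCone d) := by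
  have hquad : psdCone d = ⋂ x : Fin d → ℝ, {U | 0 ≤ x ⬝ᵥ (SymMat.toMat U).mulVec x} := by
    ext U
    have hU : (SymMat.toMat U).IsSymm := U.2
    simp [psdCone, Matrix.posSemidef_iff_dotProduct_mulVec, hU]
  rw [hquad]
  refine isClosed_iInter fun x => isClosed_le continuous_const ?_
  have htoMat : Continuous (SymMat.toMat (d := d)) :=
    LinearMap.continuous_of_finiteDimensional _
  fun_prop

theorem posHomogeneous_f2 (r : ℕ) (c : ℝ) : PosHomogeneous (f2 r c : SymMat d → ℝ) := by
  intro t ht U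
  simp only [f2, kyFan, map_smul, singularValues_smul, Real.norm_of_nonneg ht, ← Finset.mul_sum]
  ring

variable (A : SymMat d →ₗ[ℝ] EuclideanSpace ℝ (Fin p)) (b : EuclideanSpace ℝ (Fin p))

theorem continuous_f1 (n : ℕ) (c : ℝ) : Continuous (f1 n A b c) := by
  have hA : Continuous A := A.continuous_of_finiteDimensional
  unfold f1
  fun_prop

variable {A} {r : ℕ} {R : ℝ}

theorem RIPBound.sqrt_mul_norm_le (h : RIPBound A r R) {U : SymMat d} (hU : U ∈ psdCone d) :
    √(1 - R) * ‖U‖ ≤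
      ‖A U‖ + (‖A.toContinuousLinearMap‖ + √(1 - R)) * (⟪U, SymMat.ident d⟫ - kyFan r U) := by
  obtain ⟨X, hX, hXr, hUX⟩ := SymMat.exists_rank_le_norm_sub_le hU r
  have hRIP : √(1 - R) * ‖X‖ ≤ ‖A X‖ := by
    rw [← Real.sqrt_sq (norm_nonneg X), ← Real.sqrt_mul' _ (sq_nonneg _)]
    exact Real.sqrt_le_left (norm_nonneg _) |>.2 (h X hX hXr).1
  calc √(1 - R) * ‖U‖ ≤ √(1 - R) * (‖X‖ + ‖U - X‖) := by
        gcongr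
        exact norm_le_norm_add_norm_sub' U X
    _ ≤ ‖A X‖ + √(1 - R) * ‖U - X‖ := by rw [mul_add]; gcongr
    _ ≤ ‖A U‖ + ‖A (U - X)‖ + √(1 - R) * ‖U - X‖ := by
        gcongr
        rw [map_sub]
        exact norm_le_norm_add_norm_sub (A U) (A X)
    _ ≤ ‖A U‖ + ‖A.toContinuousLinearMap‖ * ‖U - X‖ + √(1 - R) * ‖U - X‖ := by
        gcongr
        exact A.toContinuousLinearMap.le_opNorm (U - X)
    _ ≤ _ := by
        rw [add_assoc, ← add_mul]
        gcongr

theorem RIPBound.isBounded_sublevel (h : RIPBound A r R) (hR : R < 1) {n : ℕ} (hn : 0 < n)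
    {c : ℝ} (hc : 0 < c) (M : ℝ) :
    Bornology.IsBounded {U ∈ psdCone d | f1 n A b c U - f2 r c U ≤ M} := by
  set δ := √(1 - R)
  have hδ : 0 < δ := Real.sqrt_pos.2 (sub_pos.2 hR)
  refine isBounded_iff_forall_norm_le.2
    ⟨(√(n * M) + ‖b‖ + (‖A.toContinuousLinearMap‖ + δ) * (M / c)) / δ, ?_⟩
  rintro U ⟨hU, hM⟩
  set gap := ⟪U, SymMat.ident d⟫ - kyFan r U
  have hgap : 0 ≤ gap := sub_nonneg.2 (SymMat.kyFan_le_inner_ident hU r)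
  have hobj : 1 / (n : ℝ) * ‖A U - b‖ ^ 2 + c * gap ≤ M := by
    convert hM using 1
    simp only [f1, f2, gap]
    ring
  have hgapM : gap ≤ M / c := by
    rw [le_div_iff₀' hc]
    exact (le_add_of_nonneg_left (by positivity)).trans hobj
  have hresidual : ‖A U - b‖ ≤ √(n * M) := by
    refine Real.le_sqrt_of_sq_le ?_
    have hle : 1 / (n : ℝ) * ‖A U - b‖ ^ 2 ≤ M :=
      (le_add_of_nonneg_right (by positivity)).trans hobj
    rwa [one_div, inv_mul_le_iff₀ (by positivity)] at hle
  rw [le_div_iff₀' hδ]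
  calc δ * ‖U‖ ≤ ‖A U‖ + (‖A.toContinuousLinearMap‖ + δ) * gap := h.sqrt_mul_norm_le hU
    _ ≤ (‖A U - b‖ + ‖b‖) + (‖A.toContinuousLinearMap‖ + δ) * gap := by
        gcongr
        exact norm_le_norm_sub_add (A U) b
    _ ≤ _ := by gcongr

end PenalizedLeastSquares

section Run

variable {d p : ℕ} {n r : ℕ} {A : SymMat d →ₗ[ℝ] EuclideanSpace ℝ (Fin p)}
  {b : EuclideanSpace ℝ (Fin p)} {c α κ tol : ℝ} {eps : ℕ → ℝ} {U V W Δ : ℕ → SymMat d}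

theorem seriousIdx_le_nth (hinf : {k | IsSerious α κ U V Δ k}.Infinite) :
    ∀ l, seriousIdx α κ U V Δ l ≤ Nat.nth (IsSerious α κ U V Δ) l
  | 0 => Nat.zero_le _
  | l + 1 => Nat.nth_strictMono hinf (Nat.lt_succ_self l)

theorem not_isSerious_of_lt_nth {l k : ℕ} (hle : seriousIdx α κ U V Δ l ≤ k)
    (hlt : k < Nat.nth (IsSerious α κ U V Δ) l) : ¬ IsSerious α κ U V Δ k := by
  cases l with
  | zero => exact Nat.notMem_of_lt_sInf (Nat.nth_zero (p := IsSerious α κ U V Δ) ▸ hlt)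
  | succ l => exact fun hk => (Nat.le_nth_of_lt_nth_succ hlt hk).not_gt (Nat.lt_of_succ_le hle)

theorem apply_nth_eq_apply_seriousIdx {β : Type*} {x : ℕ → β}
    (hx : ∀ k, ¬ IsSerious α κ U V Δ k → x (k + 1) = x k)
    (hinf : {k | IsSerious α κ U V Δ k}.Infinite) (l : ℕ) :
    x (Nat.nth (IsSerious α κ U V Δ) l) = x (seriousIdx α κ U V Δ l) := by
  have hconst : ∀ k, seriousIdx α κ U V Δ l ≤ k → k ≤ Nat.nth (IsSerious α κ U V Δ) l →
      x k = x (seriousIdx α κ U V Δ l) := by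
    intro k hk
    induction k, hk using Nat.le_induction with
    | base => exact fun _ => rfl
    | succ k hk ih =>
      exact fun hlt => (hx k (not_isSerious_of_lt_nth hk hlt)).trans (ih (Nat.le_of_succ_le hlt))
  exact hconst _ (seriousIdx_le_nth hinf l) le_rfl

theorem IsRun.isInexactProxDCSeq (hrun : IsRun n A b r c α κ tol eps U V W Δ)
    (hinf : {k | IsSerious α κ U V Δ k}.Infinite) :
    IsInexactProxDCSeq (f1 n A b c) (f2 r c) (psdCone d) α κ
      (fun l => U (seriousIdx α κ U V Δ l)) (fun l => W (seriousIdx α κ U V Δ l))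
      (fun l => Δ (seriousIdx α κ U V Δ l)) := by
  set ν := Nat.nth (IsSerious α κ U V Δ)
  have hserious : ∀ l, IsSerious α κ U V Δ (ν l) := Nat.nth_mem_of_infinite hinf
  have htrial : ∀ l, V (ν l + 1) = U (seriousIdx α κ U V Δ (l + 1)) := fun l =>
    (hrun.serious_center _ (hserious l)).symm
  have hcenter : ∀ l, U (ν l) = U (seriousIdx α κ U V Δ l) :=
    apply_nth_eq_apply_seriousIdx hrun.null_center hinf
  have hsubgrad : ∀ l, W (ν l) = W (seriousIdx α κ U V Δ l) :=
    apply_nth_eq_apply_seriousIdx hrun.null_subgrad hinf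
  refine ⟨?_, ?_, fun l => ?_, fun l => ?_⟩
  · rintro (_ | l)
    · exact hrun.init_mem
    · exact htrial l ▸ hrun.trial_mem (ν l)
  · rintro (_ | l)
    · exact hrun.init_subgrad
    · exact hrun.serious_subgrad _ (hserious l)
  · have hmin := hrun.trial_min (ν l)
    rwa [hcenter, hsubgrad, htrial] at hmin
  · have hle := (hserious l).le
    rwa [hcenter, htrial] at hle

end Run

end

theorem proposition6 {d p : ℕ} (n r : ℕ) (hn : 0 < n) (hr : 1 ≤ r) (hrd : r ≤ d)
    (A : SymMat d →ₗ[ℝ] EuclideanSpace ℝ (Fin p)) (b : EuclideanSpace ℝ (Fin p))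
    (hA : SatisfiesRIP A r)
    (c α κ : ℝ) (hc : 0 < c) (hα : 0 < α) (hκ0 : 0 < κ) (hκ1 : κ < 1)
    (eps : ℕ → ℝ) (U V W Δ : ℕ → SymMat d)
    (hrun : IsRun n A b r c α κ 0 eps U V W Δ)
    (hinf : {k | IsSerious α κ U V Δ k}.Infinite) :
    -- `E` is finite along the sequence
    (∀ l, auxE n A b r c α (seriousQuad α κ U V W Δ l) ≠ ⊤ ∧
      auxE n A b r c α (seriousQuad α κ U V W Δ l) ≠ ⊥) ∧
    -- (1)
    (∀ l, (Jc n A b r c (U (seriousIdx α κ U V Δ (l + 1))) : EReal) ≤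
      auxE n A b r c α (seriousQuad α κ U V W Δ l)) ∧
    -- (2)
    (∀ l, auxE n A b r c α (seriousQuad α κ U V W Δ (l + 1)) ≤
      auxE n A b r c α (seriousQuad α κ U V W Δ l) -
        ((κ * α / 2 *
          ‖U (seriousIdx α κ U V Δ (l + 1)) - U (seriousIdx α κ U V Δ l)‖ ^ 2 : ℝ) : EReal)) ∧
    -- (3)
    ((accPts (seriousQuad α κ U V W Δ)).Nonempty ∧
      IsCompact (accPts (seriousQuad α κ U V W Δ))) ∧
    -- (4)
    (∃ Υ : ℝ,
      Tendsto (fun l => auxE n A b r c α (seriousQuad α κ U V W Δ l)) atTop (𝓝 (Υ : EReal)) ∧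
      ∀ z ∈ accPts (seriousQuad α κ U V W Δ), auxE n A b r c α z = (Υ : EReal)) ∧
    -- (5)
    (∃ ρ : ℝ, 0 < ρ ∧ ∀ l,
      Metric.infEDist 0 (limitingSubdiff (auxE n A b r c α) (seriousQuad α κ U V W Δ l)) ≤
        ENNReal.ofReal (ρ *
          ‖U (seriousIdx α κ U V Δ (l + 1)) - U (seriousIdx α κ U V Δ l)‖)) := by
  obtain ⟨R, ⟨hR, -⟩, -, hR1⟩ := hA
  exact proposition6_general (continuous_f1 A b n c) (posHomogeneous_f2 r c) (isClosed_psdCone d)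
    zero_mem_psdCone (hR.isBounded_sublevel b hR1 hn hc) hα.le hκ0.le
    (hrun.isInexactProxDCSeq hinf)
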